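/- Let $\mathfrak A$ be a $C^*$-algebra (not necessarily unital), let $H$, $K$, $E$ be Hilbert $\mathfrak A$-modules, and let $\mathcal L(H,K)$ denote the adjointable operators from $H$ to $K$, with $\mathcal L(H)=\mathcal L(H,H)$. Write $\mathcal R(T)$ and $\mathcal N(T)$ for the range and the null space of $T$. An operator $M\in\mathcal L(K)$ is a weight if $M=M^*$ and $M$ is invertible in $\mathcal L(K)$; it is positive definite if moreover it is positive, i.e. $\langle x,Mx\rangle\ge 0$ for all $x\in K$. For weights $M\in\mathcal L(K)$, $N\in\mathcal L(H)$ and $A\in\mathcal L(H,K)$, the weighted Moore–Penrose inverse $A^\dagger_{MN}$, if it exists, is the unique $X\in\mathcal L(K,H)$ with $$AXA=A,\quad XAX=X,\quad (MAX)^*=MAX,\quad (NXA)^*=NXA,$$ and $A^\dagger=A^\dagger_{I_KI_H}$. Let $A\in\mathcal L(H,K)$, $B\in\mathcal L(H,E)$ and let $V\in\mathcal L(K)$ be positive definite. Suppose that $(\mathcal R(A^*),\mathcal R(B^*))$ is a separated pair, that is, $\mathcal R(A^*)\cap\mathcal R(B^*)=\{0\}$ and $\mathcal R(A^*)+\mathcal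 R(B^*)$ is closed in $H$. Then the projection $P_{\mathcal N(A)\cap\mathcal N(B)}\in\mathcal L(H)$ of $H$ onto $\mathcal N(A)\cap\mathcal N(B)$ exists and, for every positive definite $W\in\mathcal L(E)$ and every real $t>0$, the operator $$U=A^*VA+B^*WB+P_{\mathcal N(A)\cap\mathcal N(B)}$$ is positive definite, $A^\dagger_{VU}$ and $(A^*VA+tB^*WB)^\dagger$ exist, and $$(A^*VA+tB^*WB)^\dagger A^*V=A^\dagger_{VU}.$$ Moreover, this operator depends neither on $t>0$ nor on the positive definite operator $W$ (although $U$ depends on $W$). -/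

import Mathlib

open scoped Pointwise

/-- The set `𝓛(H, K)` of adjointable operators between the Hilbert `𝔄`-modules `H` and `K`: maps
`T : H → K` for which there is a map `T⋆ : K → H` with `⟨T x, y⟩ = ⟨x, T⋆ y⟩` for all `x`, `y`.
The map `T⋆` is determined by `T` (see `Adjointable.ext`), so it is carried along as data. As
usual, linearity over `ℂ` and over `𝔄`, and boundedness, are automatic. -/
structure Adjointable (𝔄 H K : Type*) [NonUnitalCStarAlgebra 𝔄] [PartialOrder 𝔄]
    [StarOrderedRing 𝔄]
    [NormedAddCommGroup H] [NormedSpace ℂ H] [SMul 𝔄 H] [CStarModule 𝔄 H]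
    [NormedAddCommGroup K] [NormedSpace ℂ K] [SMul 𝔄 K] [CStarModule 𝔄 K] where
  /-- the operator -/
  toFun : H → K
  /-- its adjoint -/
  adjFun : K → H
  inner_adjFun : ∀ x y, inner 𝔄 (toFun x) y = inner 𝔄 x (adjFun y)

namespace Adjointable

variable {𝔄 H K E F : Type*} [NonUnitalCStarAlgebra 𝔄] [PartialOrder 𝔄] [StarOrderedRing 𝔄]
  [NormedAddCommGroup H] [NormedSpace ℂ H] [SMul 𝔄 H] [CStarModule 𝔄 H]
  [NormedAddCommGroup K] [NormedSpace ℂ K] [SMul 𝔄 K] [CStarModule 𝔄 K]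
  [NormedAddCommGroup E] [NormedSpace ℂ E] [SMul 𝔄 E] [CStarModule 𝔄 E]
  [NormedAddCommGroup F] [NormedSpace ℂ F] [SMul 𝔄 F] [CStarModule 𝔄 F]

instance : CoeFun (Adjointable 𝔄 H K) (fun _ => H → K) := ⟨toFun⟩

theorem eq_of_inner_left_eq (𝔄 : Type*) {H : Type*} [NonUnitalCStarAlgebra 𝔄] [PartialOrder 𝔄]
    [StarOrderedRing 𝔄] [NormedAddCommGroup H] [NormedSpace ℂ H] [SMul 𝔄 H] [CStarModule 𝔄 H]
    {y z : H} (h : ∀ x : H, inner 𝔄 x y = inner 𝔄 x z) : y = z := by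
  have h1 : inner 𝔄 (y - z) (y - z) = 0 := by
    rw [CStarModule.inner_sub_right, h (y - z), sub_self]
  exact sub_eq_zero.1 (CStarModule.inner_self.1 h1)

/-- An adjointable operator is determined by its underlying map. -/
theorem ext {S T : Adjointable 𝔄 H K} (h : ∀ x, S x = T x) : S = T := by
  obtain ⟨s, s', hs⟩ := S
  obtain ⟨t, t', ht⟩ := T
  obtain rfl : s = t := funext h
  obtain rfl : s' = t' := funext fun y =>
    eq_of_inner_left_eq 𝔄 fun x => by rw [← hs, ← ht]
  rfl

/-- The adjoint operator `T⋆`. -/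
def adjoint (T : Adjointable 𝔄 H K) : Adjointable 𝔄 K H where
  toFun := T.adjFun
  adjFun := T.toFun
  inner_adjFun x y := by
    rw [← CStarModule.star_inner (A := 𝔄) y, ← T.inner_adjFun, CStarModule.star_inner]

/-- The product `S T` of adjointable operators. -/
def comp (S : Adjointable 𝔄 K E) (T : Adjointable 𝔄 H K) : Adjointable 𝔄 H E where
  toFun x := S (T x)
  adjFun y := T.adjFun (S.adjFun y)
  inner_adjFun x y := by rw [S.inner_adjFun, T.inner_adjFun]

infixr:80 " ⊚ " => Adjointable.comp

/-- The identity operator. -/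
protected def id (𝔄 H : Type*) [NonUnitalCStarAlgebra 𝔄] [PartialOrder 𝔄] [StarOrderedRing 𝔄]
    [NormedAddCommGroup H] [NormedSpace ℂ H] [SMul 𝔄 H] [CStarModule 𝔄 H] :
    Adjointable 𝔄 H H where
  toFun x := x
  adjFun x := x
  inner_adjFun _ _ := rfl

instance : Add (Adjointable 𝔄 H K) where
  add S T :=
    { toFun := fun x => S x + T x
      adjFun := fun y => S.adjFun y + T.adjFun y
      inner_adjFun := fun x y => by
        rw [CStarModule.inner_add_left, CStarModule.inner_add_right, S.inner_adjFun,
          T.inner_adjFun] }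

noncomputable instance : SMul ℝ (Adjointable 𝔄 H K) where
  smul t T :=
    { toFun := fun x => t • T x
      adjFun := fun y => t • T.adjFun y
      inner_adjFun := fun x y => by
        rw [CStarModule.inner_smul_left_real, CStarModule.inner_smul_right_real,
          T.inner_adjFun] }

/-- The range `𝓡(T)`. -/
def range (T : Adjointable 𝔄 H K) : Set K := Set.range T.toFun

/-- The null space `𝓝(T)`. -/
def ker (T : Adjointable 𝔄 H K) : Set H := {x | T x = 0}

/-- `(𝓡(A⋆), 𝓡(B⋆))` is a separated pair: the two ranges meet only in `0`, and their algebraic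
sum is (norm-)closed in `H`. -/
def IsSeparatedPair (A : Adjointable 𝔄 H K) (B : Adjointable 𝔄 H E) : Prop :=
  A.adjoint.range ∩ B.adjoint.range = {0} ∧ IsClosed (A.adjoint.range + B.adjoint.range)

/-- `M` is a weight on `K`: self-adjoint and invertible in `𝓛(K)`. -/
def IsWeight (M : Adjointable 𝔄 K K) : Prop :=
  M.adjoint = M ∧ ∃ N : Adjointable 𝔄 K K, M ⊚ N = Adjointable.id 𝔄 K ∧
    N ⊚ M = Adjointable.id 𝔄 K

/-- `T ∈ 𝓛(K)` is positive: `⟨x, T x⟩ ≥ 0` in `𝔄` for all `x`. -/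
def IsPositive (T : Adjointable 𝔄 K K) : Prop := ∀ x, 0 ≤ inner 𝔄 x (T x)

/-- Positive definite operators are the positive weights. -/
def IsPosDef (M : Adjointable 𝔄 K K) : Prop := M.IsWeight ∧ M.IsPositive

/-- `P` is the projection (self-adjoint idempotent) from `H` onto `S`. -/
def IsProjectionOnto (P : Adjointable 𝔄 H H) (S : Set H) : Prop :=
  P ⊚ P = P ∧ P.adjoint = P ∧ P.range = S

/-- `X` is the weighted Moore-Penrose inverse `A†_{MN}` with respect to the weights `M` on `K` and
`N` on `H`. -/
def IsWeightedMPInverse (M : Adjointable 𝔄 K K) (N : Adjointable 𝔄 H H)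
    (A : Adjointable 𝔄 H K) (X : Adjointable 𝔄 K H) : Prop :=
  A ⊚ X ⊚ A = A ∧ X ⊚ A ⊚ X = X ∧
    (M ⊚ A ⊚ X).adjoint = M ⊚ A ⊚ X ∧ (N ⊚ X ⊚ A).adjoint = N ⊚ X ⊚ A

/-- `X` is the Moore-Penrose inverse `A†`. -/
def IsMPInverse (A : Adjointable 𝔄 H K) (X : Adjointable 𝔄 K H) : Prop :=
  IsWeightedMPInverse (Adjointable.id 𝔄 K) (Adjointable.id 𝔄 H) A X

/-! The relations just defined determine their objects. -/

theorem comp_assoc (R : Adjointable 𝔄 E F) (S : Adjointable 𝔄 K E) (T : Adjointable 𝔄 H K) :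
    (R ⊚ S) ⊚ T = R ⊚ S ⊚ T := rfl

theorem adjoint_comp (S : Adjointable 𝔄 K E) (T : Adjointable 𝔄 H K) :
    (S ⊚ T).adjoint = T.adjoint ⊚ S.adjoint := rfl

theorem isWeight_id : (Adjointable.id 𝔄 H).IsWeight := ⟨rfl, Adjointable.id 𝔄 H, rfl, rfl⟩

theorem IsProjectionOnto.unique {P Q : Adjointable 𝔄 H H} {S : Set H}
    (hP : P.IsProjectionOnto S) (hQ : Q.IsProjectionOnto S) : P = Q := by
  have key : ∀ {P Q : Adjointable 𝔄 H H}, P ⊚ P = P → P.range = Q.range → P ⊚ Q = Q := by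
    intro P Q h1 h2
    refine ext fun x => ?_
    have h3 : Q x ∈ P.range := h2 ▸ ⟨x, rfl⟩
    obtain ⟨y, hy⟩ := h3
    change P (Q x) = Q x
    rw [← hy]
    exact congrArg (fun T : Adjointable 𝔄 H H => T y) h1
  have h1 := key hP.1 (hP.2.2.trans hQ.2.2.symm)
  have h2 := key hQ.1 (hQ.2.2.trans hP.2.2.symm)
  have h3 := congrArg adjoint h1
  rw [adjoint_comp, hP.2.1, hQ.2.1, h2] at h3
  exact h3

/-- If `p`, `q` are idempotents with the same range that are self-adjoint with respect to a
weight, then they are equal. -/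
theorem eq_of_weighted_projections {M p q : Adjointable 𝔄 K K} (hM : M.IsWeight)
    (hp : (M ⊚ p).adjoint = M ⊚ p) (hq : (M ⊚ q).adjoint = M ⊚ q)
    (hpq : p ⊚ q = q) (hqp : q ⊚ p = p) : p = q := by
  obtain ⟨hM, N, -, hN⟩ := hM
  rw [adjoint_comp, hM] at hp hq
  have h : M ⊚ p = M ⊚ q := by
    calc M ⊚ p = M ⊚ q ⊚ p := by rw [hqp]
      _ = (M ⊚ q) ⊚ p := rfl
      _ = q.adjoint ⊚ M ⊚ p := by rw [← hq]; rfl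
      _ = (p ⊚ q).adjoint ⊚ M := by rw [← hp]; rfl
      _ = M ⊚ q := by rw [hpq, hq]
  have h2 : (N ⊚ M) ⊚ p = (N ⊚ M) ⊚ q := congrArg (fun T => N ⊚ T) h
  rw [hN] at h2
  exact h2

theorem eq_of_weighted_projections' {M p q : Adjointable 𝔄 K K} (hM : M.IsWeight)
    (hp : (M ⊚ p).adjoint = M ⊚ p) (hq : (M ⊚ q).adjoint = M ⊚ q)
    (hpq : p ⊚ q = p) (hqp : q ⊚ p = q) : p = q := by
  obtain ⟨hM, N, -, hN⟩ := hM
  rw [adjoint_comp, hM] at hp hq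
  have h : M ⊚ p = M ⊚ q := by
    calc M ⊚ p = p.adjoint ⊚ M := hp.symm
      _ = (p ⊚ q).adjoint ⊚ M := by rw [hpq]
      _ = q.adjoint ⊚ p.adjoint ⊚ M := rfl
      _ = q.adjoint ⊚ M ⊚ p := by rw [hp]
      _ = (q.adjoint ⊚ M) ⊚ p := rfl
      _ = M ⊚ q ⊚ p := by rw [hq]; rfl
      _ = M ⊚ q := by rw [hqp]
  have h2 : (N ⊚ M) ⊚ p = (N ⊚ M) ⊚ q := congrArg (fun T => N ⊚ T) h
  rw [hN] at h2
  exact h2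

theorem IsWeightedMPInverse.unique {M : Adjointable 𝔄 K K} {N : Adjointable 𝔄 H H}
    {A : Adjointable 𝔄 H K} {X Y : Adjointable 𝔄 K H} (hM : M.IsWeight) (hN : N.IsWeight)
    (hX : IsWeightedMPInverse M N A X) (hY : IsWeightedMPInverse M N A Y) : X = Y := by
  obtain ⟨x1, x2, x3, x4⟩ := hX
  obtain ⟨y1, y2, y3, y4⟩ := hY
  have h1 : A ⊚ X = A ⊚ Y := eq_of_weighted_projections hM x3 y3
    (congrArg (fun T => T ⊚ Y) x1) (congrArg (fun T => T ⊚ X) y1)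
  have h2 : X ⊚ A = Y ⊚ A := eq_of_weighted_projections' hN x4 y4
    (congrArg (fun T => X ⊚ T) y1) (congrArg (fun T => Y ⊚ T) x1)
  calc X = X ⊚ A ⊚ X := x2.symm
    _ = X ⊚ A ⊚ Y := by rw [h1]
    _ = (X ⊚ A) ⊚ Y := rfl
    _ = Y ⊚ A ⊚ Y := by rw [h2]; rfl
    _ = Y := y2

end Adjointable

/-! Write S = A⋆VA + B⋆WB, R = 𝓡(A⋆) + 𝓡(B⋆), and let P project onto 𝓝(A) ∩ 𝓝(B). Each half of the
separation hypothesis does one job.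

Closedness of R gives P and the invertibility of U = S + P. Closed submodules of Hilbert modules
need not be complemented, so this takes analysis: by open mapping ‖A x‖ + ‖B x‖ controls ‖x‖ on R
(`exists_norm_le_of_isClosed`), hence the operators S + s, s ≥ 0, are uniformly bounded below there,
and the continuity method yields S(R) = R (`exists_weightedSum_eq`). Then H is the orthogonal sum of
𝓝(A) ∩ 𝓝(B) and R, with U the identity on the first and S on the second.

Trivial intersection gives independence of W (`apply_inverse_adjoint`). For q = U⁻¹A⋆k, applying P
gives Pq = 0, so B⋆WBq = A⋆(k - VAq) lies in both ranges and vanishes; hence Bq = 0, and Uq = A⋆k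
whatever W is. So X = U⁻¹A⋆V is one operator for all W, and A⋆VAq = A⋆k yields the Penrose
equations. Finally t is absorbed into W, and S† = U⁻¹ - P has S†A⋆ = U⁻¹A⋆ because PA⋆ = 0. -/

/-! ### The continuity method -/

/-- A bounded operator `G` on a Banach space such that all `G + s`, `s ≥ 0`, are bounded below by
one constant is surjective. -/
theorem ContinuousLinearMap.surjective_of_forall_add_smul_bounded_below {X : Type*}
    [NormedAddCommGroup X] [NormedSpace ℂ X] [CompleteSpace X] (G : X →L[ℂ] X) {c : ℝ}
    (hc : 0 < c) (h : ∀ s : ℝ, 0 ≤ s → ∀ x, c * ‖x‖ ≤ ‖G x + (s : ℂ) • x‖) :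
    Function.Surjective G := by
  rcases subsingleton_or_nontrivial X with hX | hX
  · exact fun y => ⟨y, Subsingleton.elim _ _⟩
  let T : ℝ → X →L[ℂ] X := fun s => G + (s : ℂ) • 1
  have hTx : ∀ s x, T s x = G x + (s : ℂ) • x := fun s x => rfl
  -- The lower bound makes every inverse have norm at most c⁻¹, so invertibility spreads over a
  -- radius independent of s.
  have step : ∀ s s' : ℝ, 0 ≤ s → |s' - s| < c → IsUnit (T s) → IsUnit (T s') := by
    rintro s s' hs hss ⟨u, hu⟩
    refine (u.ofNearby (T s') ?_).isUnit
    have h1 : ‖(↑u⁻¹ : X →L[ℂ] X)‖ ≤ c⁻¹ := by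
      refine ContinuousLinearMap.opNorm_le_bound _ (by positivity) fun x => ?_
      have h2 := h s hs ((↑u⁻¹ : X →L[ℂ] X) x)
      rw [← hTx, ← hu, ← mul_apply_eq_comp, Units.mul_inv,
        one_apply_eq_self] at h2
      rwa [inv_mul_eq_div, le_div_iff₀' hc]
    have h3 : T s' - u = ((s' - s : ℝ) : ℂ) • (1 : X →L[ℂ] X) := by
      rw [hu]
      simp only [T, Complex.ofReal_sub, sub_smul]
      abel
    rw [h3, norm_smul, Complex.norm_real, Real.norm_eq_abs, norm_one, mul_one]
    exact hss.trans_le ((le_inv_comm₀ hc (Units.norm_pos _)).2 h1)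
  have start : IsUnit (T (‖G‖ + 1)) := by
    let u : (X →L[ℂ] X)ˣ := Units.mk0 ((‖G‖ + 1 : ℝ) : ℂ)
      (by exact_mod_cast (by positivity : ‖G‖ + 1 ≠ 0)) |>.map (algebraMap ℂ (X →L[ℂ] X))
    refine (u.ofNearby _ ?_).isUnit
    have h1 : T (‖G‖ + 1) - u = G := by
      change G + ((‖G‖ + 1 : ℝ) : ℂ) • (1 : X →L[ℂ] X)
        - algebraMap ℂ (X →L[ℂ] X) ((‖G‖ + 1 : ℝ) : ℂ) = G
      rw [Algebra.algebraMap_eq_smul_one, add_sub_cancel_right]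
    have h2 : ‖(↑u⁻¹ : X →L[ℂ] X)‖⁻¹ = ‖G‖ + 1 := by
      have : (↑u⁻¹ : X →L[ℂ] X)
          = algebraMap ℂ (X →L[ℂ] X) ((‖G‖ + 1 : ℝ) : ℂ)⁻¹ := by
        simp only [u, ← map_inv]
        rfl
      rw [this, norm_algebraMap', norm_inv, inv_inv, Complex.norm_real, Real.norm_eq_abs,
        abs_of_nonneg (by positivity)]
    rw [h1, h2]
    exact lt_add_one _
  -- Steps of c / 2 stay strictly within that radius; truncation at 0 keeps s in the range where the
  -- lower bound holds and makes the descent end at G.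
  have descent : ∀ n : ℕ, IsUnit (T (max (‖G‖ + 1 - n * (c / 2)) 0)) := by
    intro n
    induction n with
    | zero => simpa [max_eq_left (by positivity : 0 ≤ ‖G‖ + 1)] using start
    | succ n ih =>
      refine step _ _ (le_max_right _ _) ?_ ih
      refine (abs_max_sub_max_le_abs _ _ _).trans_lt ?_
      push_cast
      rw [abs_lt]
      constructor <;> linarith
  obtain ⟨n, hn⟩ := exists_nat_ge ((‖G‖ + 1) / (c / 2))
  have h0 := descent n
  rw [div_le_iff₀ (by positivity)] at hn
  rw [max_eq_right (by linarith)] at h0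
  obtain ⟨u, hu⟩ := h0
  intro y
  refine ⟨(↑u⁻¹ : X →L[ℂ] X) y, ?_⟩
  have h4 : ((u : X →L[ℂ] X) * (↑u⁻¹ : X →L[ℂ] X)) y = y := by
    rw [Units.mul_inv, one_apply_eq_self]
  rwa [hu, mul_apply_eq_comp, hTx, Complex.ofReal_zero, zero_smul, add_zero] at h4

namespace Adjointable

variable {𝔄 H K E : Type*} [NonUnitalCStarAlgebra 𝔄] [PartialOrder 𝔄] [StarOrderedRing 𝔄]
  [NormedAddCommGroup H] [NormedSpace ℂ H] [SMul 𝔄 H] [CStarModule 𝔄 H]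
  [NormedAddCommGroup K] [NormedSpace ℂ K] [SMul 𝔄 K] [CStarModule 𝔄 K]
  [NormedAddCommGroup E] [NormedSpace ℂ E] [SMul 𝔄 E] [CStarModule 𝔄 E]

/-! ### Linearity and boundedness of adjointable operators -/

theorem inner_adjoint_right (T : Adjointable 𝔄 H K) (x : H) (y : K) :
    inner 𝔄 x (T.adjoint y) = inner 𝔄 (T x) y :=
  (T.inner_adjFun x y).symm

theorem inner_adjoint_left (T : Adjointable 𝔄 H K) (x : K) (y : H) :
    inner 𝔄 (T.adjoint x) y = inner 𝔄 x (T y) :=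
  T.adjoint.inner_adjFun x y

@[simp] theorem comp_apply (S : Adjointable 𝔄 K E) (T : Adjointable 𝔄 H K) (x : H) :
    (S ⊚ T) x = S (T x) := rfl

@[simp] theorem add_apply (S T : Adjointable 𝔄 H K) (x : H) : (S + T) x = S x + T x := rfl

@[simp] theorem smul_apply (t : ℝ) (T : Adjointable 𝔄 H K) (x : H) : (t • T) x = t • T x := rfl

@[simp] theorem id_apply (x : H) : Adjointable.id 𝔄 H x = x := rfl

theorem adjoint_add (S T : Adjointable 𝔄 H K) : (S + T).adjoint = S.adjoint + T.adjoint := rfl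

theorem adjoint_smul (t : ℝ) (T : Adjointable 𝔄 H K) : (t • T).adjoint = t • T.adjoint := rfl

theorem adjoint_adjoint (T : Adjointable 𝔄 H K) : T.adjoint.adjoint = T := rfl

/-- An adjointable operator as a `ℂ`-linear map. -/
def toLinearMap (T : Adjointable 𝔄 H K) : H →ₗ[ℂ] K where
  toFun := T
  map_add' x y := eq_of_inner_left_eq 𝔄 fun z => by
    rw [CStarModule.inner_add_right, ← T.inner_adjoint_left, ← T.inner_adjoint_left,
      ← T.inner_adjoint_left, CStarModule.inner_add_right]
  map_smul' c x := eq_of_inner_left_eq 𝔄 fun z => by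
    rw [RingHom.id_apply, CStarModule.inner_smul_right_complex, ← T.inner_adjoint_left,
      ← T.inner_adjoint_left, CStarModule.inner_smul_right_complex]

theorem map_add (T : Adjointable 𝔄 H K) (x y : H) : T (x + y) = T x + T y :=
  T.toLinearMap.map_add x y

theorem map_sub (T : Adjointable 𝔄 H K) (x y : H) : T (x - y) = T x - T y :=
  T.toLinearMap.map_sub x y

theorem map_zero (T : Adjointable 𝔄 H K) : T 0 = 0 := T.toLinearMap.map_zero

theorem map_smul_complex (T : Adjointable 𝔄 H K) (c : ℂ) (x : H) : T (c • x) = c • T x :=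
  T.toLinearMap.map_smul c x

theorem map_smul_real (T : Adjointable 𝔄 H K) (t : ℝ) (x : H) : T (t • x) = t • T x := by
  rw [← Complex.coe_smul, ← Complex.coe_smul, T.map_smul_complex]

/-- An adjointable operator between Hilbert modules is bounded, by the closed graph theorem. -/
def toCLM [CompleteSpace H] [CompleteSpace K] (T : Adjointable 𝔄 H K) : H →L[ℂ] K where
  toLinearMap := T.toLinearMap
  cont := T.toLinearMap.continuous_of_seq_closed_graph fun u x y hu hTu =>
    eq_of_inner_left_eq 𝔄 fun z => by
      have h1 : Filter.Tendsto (fun n => inner 𝔄 z (T (u n))) Filter.atTop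
          (nhds (inner 𝔄 z y)) :=
        ((CStarModule.innerSL (A := 𝔄) z).continuous.tendsto y).comp hTu
      have h2 : Filter.Tendsto (fun n => inner 𝔄 (T.adjoint z) (u n)) Filter.atTop
          (nhds (inner 𝔄 (T.adjoint z) x)) :=
        ((CStarModule.innerSL (A := 𝔄) (T.adjoint z)).continuous.tendsto x).comp hu
      simp only [T.inner_adjoint_left] at h2
      exact tendsto_nhds_unique h1 h2

/-! ### Positive definite operators -/

/-- A positive definite operator is bounded below as a quadratic form. -/
theorem IsPosDef.exists_le_norm_inner [CompleteSpace K] {V : Adjointable 𝔄 K K}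
    (hV : V.IsPosDef) : ∃ c > 0, ∀ y : K, c * ‖y‖ ^ 2 ≤ ‖(inner 𝔄 y (V y) : 𝔄)‖ := by
  obtain ⟨⟨hsa, N, hN, -⟩, hpos⟩ := hV
  have hVN : ∀ y, V (N y) = y := fun y => congrArg (fun T : Adjointable 𝔄 K K => T y) hN
  set m := ‖N.toCLM‖ + 1
  have hm : 0 < m := by positivity
  refine ⟨m⁻¹, inv_pos.2 hm, fun y => ?_⟩
  set s := m⁻¹
  have hs : 0 < s := inv_pos.2 hm
  have hNy : ‖(inner 𝔄 (N y) y : 𝔄)‖ ≤ m * ‖y‖ ^ 2 := by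
    calc ‖(inner 𝔄 (N y) y : 𝔄)‖ ≤ ‖N y‖ * ‖y‖ := CStarModule.norm_inner_le K
      _ ≤ (m * ‖y‖) * ‖y‖ := by
        gcongr
        refine (N.toCLM.le_opNorm y).trans ?_
        gcongr
        exact le_add_of_nonneg_right zero_le_one
      _ = m * ‖y‖ ^ 2 := by ring
  have hNV : (inner 𝔄 (N y) (V y) : 𝔄) = inner 𝔄 y y := by
    rw [← V.inner_adjoint_left, hsa, hVN]
  -- With N = V⁻¹ this expands to 2s⟨y, y⟩ ≤ s²⟨Ny, y⟩ + ⟨y, Vy⟩, avoiding square roots of V; s =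
  -- m⁻¹ makes the N term at most s‖y‖² in norm.
  have h0 := hpos (s • N y - y)
  rw [V.map_sub, V.map_smul_real, hVN] at h0
  simp only [CStarModule.inner_sub_left, CStarModule.inner_sub_right,
    CStarModule.inner_smul_left_real, CStarModule.inner_smul_right_real, hNV] at h0
  have h1 : (2 * s) • (inner 𝔄 y y : 𝔄)
      ≤ (s * s) • (inner 𝔄 (N y) y : 𝔄) + inner 𝔄 y (V y) := by
    rw [← sub_nonneg]
    convert h0 using 1
    module
  have h2 := CStarAlgebra.norm_le_norm_of_nonneg_of_le
    (smul_nonneg (by positivity) CStarModule.inner_self_nonneg) h1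
  rw [norm_smul, ← CStarModule.norm_sq_eq, Real.norm_eq_abs, abs_of_pos (by positivity)] at h2
  have h3 := h2.trans (norm_add_le _ _)
  rw [norm_smul, Real.norm_eq_abs, abs_of_pos (by positivity)] at h3
  have h4 : s * s * ‖(inner 𝔄 (N y) y : 𝔄)‖ ≤ s * ‖y‖ ^ 2 := by
    calc s * s * ‖(inner 𝔄 (N y) y : 𝔄)‖ ≤ s * s * (m * ‖y‖ ^ 2) := by gcongr
      _ = s * ‖y‖ ^ 2 * (s * m) := by ring
      _ = s * ‖y‖ ^ 2 := by rw [inv_mul_cancel₀ hm.ne', mul_one]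
  linarith

theorem IsPosDef.eq_zero_of_inner_eq_zero [CompleteSpace K] {V : Adjointable 𝔄 K K}
    (hV : V.IsPosDef) {y : K} (h : (inner 𝔄 y (V y) : 𝔄) = 0) : y = 0 := by
  obtain ⟨c, hc, hy⟩ := hV.exists_le_norm_inner
  have h1 := hy y
  rw [h, norm_zero] at h1
  have h2 : ‖y‖ ^ 2 ≤ 0 := nonpos_of_mul_nonpos_right h1 hc
  exact norm_eq_zero.1 (pow_eq_zero_iff two_ne_zero |>.1 (le_antisymm h2 (by positivity)))

theorem isPosDef_id : (Adjointable.id 𝔄 H).IsPosDef :=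
  ⟨isWeight_id, fun _ => CStarModule.inner_self_nonneg⟩

theorem IsPosDef.smul {V : Adjointable 𝔄 K K} (hV : V.IsPosDef) {t : ℝ} (ht : 0 < t) :
    (t • V).IsPosDef := by
  obtain ⟨⟨hsa, N, hVN, hNV⟩, hpos⟩ := hV
  refine ⟨⟨by rw [adjoint_smul, hsa], t⁻¹ • N, ext fun x => ?_, ext fun x => ?_⟩, fun x => ?_⟩
  · have h : V (N x) = x := congrArg (fun T : Adjointable 𝔄 K K => T x) hVN
    simp [V.map_smul_real, h, ht.ne']
  · have h : N (V x) = x := congrArg (fun T : Adjointable 𝔄 K K => T x) hNV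
    simp [N.map_smul_real, h, ht.ne']
  · rw [smul_apply, CStarModule.inner_smul_right_real]
    exact smul_nonneg ht.le (hpos x)

/-! ### Algebra of the weighted sum and its inverse -/

/-- The operator `A⋆ V A + B⋆ W B`. -/
def weightedSum (A : Adjointable 𝔄 H K) (B : Adjointable 𝔄 H E) (V : Adjointable 𝔄 K K)
    (W : Adjointable 𝔄 E E) : Adjointable 𝔄 H H :=
  A.adjoint ⊚ V ⊚ A + B.adjoint ⊚ W ⊚ B

section weightedSum

variable {A : Adjointable 𝔄 H K} {B : Adjointable 𝔄 H E} {V : Adjointable 𝔄 K K}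
  {W : Adjointable 𝔄 E E} {P : Adjointable 𝔄 H H}

theorem weightedSum_apply (x : H) :
    weightedSum A B V W x = A.adjoint (V (A x)) + B.adjoint (W (B x)) := rfl

theorem inner_weightedSum (x : H) : (inner 𝔄 x (weightedSum A B V W x) : 𝔄) =
    inner 𝔄 (A x) (V (A x)) + inner 𝔄 (B x) (W (B x)) := by
  rw [weightedSum_apply, CStarModule.inner_add_right, inner_adjoint_right, inner_adjoint_right]

theorem adjoint_weightedSum (hV : V.IsPosDef) (hW : W.IsPosDef) :
    (weightedSum A B V W).adjoint = weightedSum A B V W := by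
  have h : (weightedSum A B V W).adjoint = weightedSum A B V.adjoint W.adjoint := rfl
  rw [h, hV.1.1, hW.1.1]

theorem weightedSum_mem (x : H) :
    weightedSum A B V W x ∈ A.adjoint.range + B.adjoint.range :=
  Set.add_mem_add ⟨_, rfl⟩ ⟨_, rfl⟩

theorem inner_eq_zero_of_mem {r n : H} (hr : r ∈ A.adjoint.range + B.adjoint.range)
    (hn : n ∈ A.ker ∩ B.ker) : (inner 𝔄 r n : 𝔄) = 0 := by
  obtain ⟨_, ⟨k, rfl⟩, _, ⟨e, rfl⟩, rfl⟩ := hr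
  have h1 : A n = 0 := hn.1
  have h2 : B n = 0 := hn.2
  change inner 𝔄 (A.adjoint k + B.adjoint e) n = 0
  rw [CStarModule.inner_add_left, inner_adjoint_left, inner_adjoint_left, h1, h2]
  simp

/-- The form is a sum of two nonnegative elements of 𝔄, so both vanish, and definiteness of the
weights applies to each. -/
theorem mem_ker_inter_ker [CompleteSpace K] [CompleteSpace E] (hV : V.IsPosDef)
    (hW : W.IsPosDef) {x : H} (hx : (inner 𝔄 x (weightedSum A B V W x) : 𝔄) = 0) :
    x ∈ A.ker ∩ B.ker := by
  rw [inner_weightedSum] at hx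
  obtain ⟨h1, h2⟩ := (add_eq_zero_iff_of_nonneg (hV.2 _) (hW.2 _)).1 hx
  exact ⟨hV.eq_zero_of_inner_eq_zero h1, hW.eq_zero_of_inner_eq_zero h2⟩

theorem weightedSum_eq_zero {x : H} (hx : x ∈ A.ker ∩ B.ker) : weightedSum A B V W x = 0 := by
  have h1 : A x = 0 := hx.1
  have h2 : B x = 0 := hx.2
  simp [weightedSum_apply, h1, h2, map_zero]

theorem IsProjectionOnto.apply_apply {S : Set H} (hP : P.IsProjectionOnto S) (x : H) :
    P (P x) = P x := congrArg (fun T : Adjointable 𝔄 H H => T x) hP.1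

theorem IsProjectionOnto.apply_mem (hP : P.IsProjectionOnto (A.ker ∩ B.ker)) (x : H) :
    P x ∈ A.ker ∩ B.ker := hP.2.2 ▸ ⟨x, rfl⟩

theorem IsProjectionOnto.apply_eq_zero (hP : P.IsProjectionOnto (A.ker ∩ B.ker)) {r : H}
    (hr : r ∈ A.adjoint.range + B.adjoint.range) : P r = 0 :=
  eq_of_inner_left_eq 𝔄 fun x => by
    rw [CStarModule.inner_zero_right, ← P.inner_adjoint_left, hP.2.1, ← CStarModule.star_inner,
      inner_eq_zero_of_mem hr (hP.apply_mem x), star_zero]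

/-- If `Q` is inverse to `A⋆ V A + B⋆ W B + P` and `𝓡(A⋆) ∩ 𝓡(B⋆) = {0}`, then `A⋆ V A` inverts
`Q` on `𝓡(A⋆)`, while `B` and `P` vanish on `Q 𝓡(A⋆)`. -/
theorem apply_inverse_adjoint [CompleteSpace E]
    (hAB : A.adjoint.range ∩ B.adjoint.range = {0}) (hW : W.IsPosDef)
    (hP : P.IsProjectionOnto (A.ker ∩ B.ker)) {Q : Adjointable 𝔄 H H}
    (hQ : (weightedSum A B V W + P) ⊚ Q = Adjointable.id 𝔄 H) (k : K) :
    A.adjoint (V (A (Q (A.adjoint k)))) = A.adjoint k ∧ B (Q (A.adjoint k)) = 0 ∧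
      P (Q (A.adjoint k)) = 0 := by
  set q := Q (A.adjoint k)
  have hUq : weightedSum A B V W q + P q = A.adjoint k :=
    congrArg (fun T : Adjointable 𝔄 H H => T (A.adjoint k)) hQ
  have hPq : P q = 0 := by
    have h1 := congrArg P.toFun hUq
    have hk : A.adjoint k ∈ A.adjoint.range + B.adjoint.range := by
      rw [← add_zero (A.adjoint k)]
      exact Set.add_mem_add ⟨k, rfl⟩ ⟨0, B.adjoint.map_zero⟩
    rwa [map_add, hP.apply_eq_zero (weightedSum_mem q), hP.apply_apply, zero_add,
      hP.apply_eq_zero hk] at h1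
  rw [hPq, add_zero, weightedSum_apply] at hUq
  -- The only use of the trivial intersection of the ranges.
  have hB : B.adjoint (W (B q)) = 0 := by
    have h1 : B.adjoint (W (B q)) ∈ A.adjoint.range ∩ B.adjoint.range := by
      refine ⟨⟨k - V (A q), ?_⟩, ⟨_, rfl⟩⟩
      rw [map_sub, ← hUq, add_sub_cancel_left]
    rwa [hAB] at h1
  refine ⟨by rwa [hB, add_zero] at hUq, hW.eq_zero_of_inner_eq_zero (𝔄 := 𝔄) ?_, hPq⟩
  rw [← B.inner_adjoint_right, hB, CStarModule.inner_zero_right]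

/-- On `𝓡(A⋆)` the inverse of `A⋆ V A + B⋆ W B + P` does not depend on `W`. -/
theorem inverse_comp_adjoint_eq [CompleteSpace E]
    (hAB : A.adjoint.range ∩ B.adjoint.range = {0}) (hW : W.IsPosDef)
    (hP : P.IsProjectionOnto (A.ker ∩ B.ker)) {W' : Adjointable 𝔄 E E} {Q Q' : Adjointable 𝔄 H H}
    (hQ : (weightedSum A B V W + P) ⊚ Q = Adjointable.id 𝔄 H)
    (hQ' : Q' ⊚ (weightedSum A B V W' + P) = Adjointable.id 𝔄 H) :
    Q' ⊚ A.adjoint = Q ⊚ A.adjoint := by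
  refine ext fun k => ?_
  obtain ⟨h1, h2, h3⟩ := apply_inverse_adjoint hAB hW hP hQ k
  have h4 : (weightedSum A B V W' + P) (Q (A.adjoint k)) = A.adjoint k := by
    rw [add_apply, weightedSum_apply, h1, h2, h3, map_zero, map_zero, add_zero, add_zero]
  rw [comp_apply, comp_apply, ← h4]
  exact congrArg (fun T : Adjointable 𝔄 H H => T (Q (A.adjoint k))) hQ' |>.trans (by rw [h4]; rfl)

theorem adjoint_inverse {U Q : Adjointable 𝔄 H H} (hU : U.adjoint = U)
    (hQ : U ⊚ Q = Adjointable.id 𝔄 H) : Q.adjoint = Q := by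
  have h : Q.adjoint ⊚ U = Adjointable.id 𝔄 H := by
    conv_lhs => rw [← hU, ← adjoint_comp, hQ]
    rfl
  calc Q.adjoint = Q.adjoint ⊚ U ⊚ Q := by rw [hQ]; rfl
    _ = (Q.adjoint ⊚ U) ⊚ Q := rfl
    _ = Q := by rw [h]; rfl

/-- The weighted Moore-Penrose inverse of `A` in terms of the inverse of
`U = A⋆ V A + B⋆ W B + P`. -/
theorem isWeightedMPInverse_inverse_comp [CompleteSpace E]
    (hAB : A.adjoint.range ∩ B.adjoint.range = {0})
    (hV : V.IsPosDef) (hW : W.IsPosDef) (hP : P.IsProjectionOnto (A.ker ∩ B.ker))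
    {Q : Adjointable 𝔄 H H} (hQ : (weightedSum A B V W + P) ⊚ Q = Adjointable.id 𝔄 H) :
    IsWeightedMPInverse V (weightedSum A B V W + P) A (Q ⊚ A.adjoint ⊚ V) := by
  have hUsa : (weightedSum A B V W + P).adjoint = weightedSum A B V W + P := by
    rw [adjoint_add, adjoint_weightedSum hV hW, hP.2.1]
  have hQsa := adjoint_inverse hUsa hQ
  have key : A.adjoint ⊚ V ⊚ A ⊚ Q ⊚ A.adjoint = A.adjoint :=
    ext fun k => (apply_inverse_adjoint hAB hW hP hQ k).1
  refine ⟨?_, ?_, ?_, ?_⟩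
  -- AXA = A is the adjoint of `key`.
  · have h := congrArg adjoint key
    simp only [adjoint_comp, adjoint_adjoint, hQsa, hV.1.1] at h
    exact h
  · exact congrArg (fun T => Q ⊚ T ⊚ V) key
  · simp only [adjoint_comp, adjoint_adjoint, hQsa, hV.1.1, comp_assoc]
  -- The weight U cancels its inverse in X, leaving the self-adjoint A⋆VA.
  · have h : (weightedSum A B V W + P) ⊚ (Q ⊚ A.adjoint ⊚ V) ⊚ A = A.adjoint ⊚ V ⊚ A :=
      congrArg (fun T => T ⊚ A.adjoint ⊚ V ⊚ A) hQ
    rw [h]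
    simp only [adjoint_comp, adjoint_adjoint, hV.1.1, comp_assoc]

/-- The Moore-Penrose inverse of `S = A⋆ V A + B⋆ W B` is `(S + P)⁻¹ (1 - P)`. -/
theorem exists_isMPInverse_weightedSum (hV : V.IsPosDef) (hW : W.IsPosDef)
    (hP : P.IsProjectionOnto (A.ker ∩ B.ker))
    {Q : Adjointable 𝔄 H H} (hQ : (weightedSum A B V W + P) ⊚ Q = Adjointable.id 𝔄 H)
    (hQ' : Q ⊚ (weightedSum A B V W + P) = Adjointable.id 𝔄 H) :
    ∃ Y : Adjointable 𝔄 H H, IsMPInverse (weightedSum A B V W) Y ∧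
      Y ⊚ A.adjoint ⊚ V = Q ⊚ A.adjoint ⊚ V := by
  set S := weightedSum A B V W
  have hSsa : S.adjoint = S := adjoint_weightedSum hV hW
  have hQsa := adjoint_inverse (by rw [adjoint_add, hSsa, hP.2.1]) hQ
  have hSQ : ∀ x, S (Q x) + P (Q x) = x := fun x =>
    congrArg (fun T : Adjointable 𝔄 H H => T x) hQ
  have hQS : ∀ x, Q (S x + P x) = x := fun x =>
    congrArg (fun T : Adjointable 𝔄 H H => T x) hQ'
  have hPS : ∀ x, P (S x) = 0 := fun x => hP.apply_eq_zero (weightedSum_mem x)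
  have hSP : ∀ x, S (P x) = 0 := fun x => weightedSum_eq_zero (hP.apply_mem x)
  have hQP : ∀ x, Q (P x) = P x := fun x => by
    have h := hQS (P x)
    rwa [hSP, hP.apply_apply, zero_add] at h
  have hPQ : ∀ x, P (Q x) = P x := fun x => by
    have h := congrArg P.toFun (hSQ x)
    rwa [map_add, hPS, hP.apply_apply, zero_add] at h
  -- Q is the identity on the range of P, so subtracting P leaves the inverse of S on the
  -- complement.
  let Y : Adjointable 𝔄 H H := Q + (-1 : ℝ) • P
  have hY : ∀ x, Y x = Q x - P x := fun x => by
    simp [Y, sub_eq_add_neg]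
  have hYsa : Y.adjoint = Y := by
    rw [adjoint_add, adjoint_smul, hQsa, hP.2.1]
  have hSY : ∀ x, S (Y x) = x - P x := fun x => by
    rw [hY, map_sub, hSP, sub_zero, eq_sub_iff_add_eq]
    nth_rewrite 1 [← hPQ x]
    exact hSQ x
  have hYS : ∀ x, Y (S x) = x - P x := fun x => by
    rw [hY, hPS, sub_zero, eq_sub_iff_add_eq]
    nth_rewrite 1 [← hQP x]
    rw [← map_add]
    exact hQS x
  have hcomm : S ⊚ Y = Y ⊚ S := ext fun x => (hSY x).trans (hYS x).symm
  refine ⟨Y, ⟨ext fun x => ?_, ext fun x => ?_, ?_, ?_⟩, ext fun k => ?_⟩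
  · change S (Y (S x)) = S x
    rw [hSY, hPS, sub_zero]
  · change Y (S (Y x)) = Y x
    rw [hYS, hY, map_sub, hPQ, hP.apply_apply, sub_self, sub_zero]
  · change (S ⊚ Y).adjoint = S ⊚ Y
    rw [adjoint_comp, hSsa, hYsa, hcomm]
  · change (Y ⊚ S).adjoint = Y ⊚ S
    rw [adjoint_comp, hSsa, hYsa, hcomm]
  · change Y (A.adjoint (V k)) = Q (A.adjoint (V k))
    rw [hY, sub_eq_self]
    refine hP.apply_eq_zero ?_
    rw [← add_zero (A.adjoint (V k))]
    exact Set.add_mem_add ⟨_, rfl⟩ ⟨0, B.adjoint.map_zero⟩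

/-- Lets the parameter t be treated as a change of the weight W. -/
theorem weightedSum_smul (t : ℝ) :
    weightedSum A B V (t • W) = A.adjoint ⊚ V ⊚ A + t • (B.adjoint ⊚ W ⊚ B) :=
  ext fun x => congrArg (A.adjoint (V (A x)) + ·) (B.adjoint.map_smul_real t (W (B x)))

variable [CompleteSpace H] [CompleteSpace K] [CompleteSpace E]

/-! ### Consequences of the closed range sum -/

/-- If `𝓡(A⋆) + 𝓡(B⋆)` is closed, then `x ↦ (A x, B x)` is bounded below on it. -/
theorem exists_norm_le_of_isClosed (hcl : IsClosed (A.adjoint.range + B.adjoint.range)) :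
    ∃ c > 0, ∀ x ∈ A.adjoint.range + B.adjoint.range, ‖x‖ ≤ c * (‖A x‖ + ‖B x‖) := by
  let T : K × E →L[ℂ] H := A.adjoint.toCLM.coprod B.adjoint.toCLM
  have hT : ∀ p, T p = A.adjoint p.1 + B.adjoint p.2 := fun p => rfl
  have hR : (LinearMap.range (T : K × E →ₗ[ℂ] H) : Set H)
      = A.adjoint.range + B.adjoint.range := by
    ext x
    constructor
    · rintro ⟨p, rfl⟩
      exact Set.add_mem_add ⟨_, rfl⟩ ⟨_, rfl⟩
    · rintro ⟨_, ⟨k, rfl⟩, _, ⟨e, rfl⟩, rfl⟩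
      exact ⟨(k, e), rfl⟩
  rw [← hR] at hcl
  have : CompleteSpace (LinearMap.range (T : K × E →ₗ[ℂ] H)) := hcl.completeSpace_coe
  -- Open mapping onto the closed, hence complete, range: x = A⋆k + B⋆e with k, e of norm at most
  -- c‖x‖. Pairing x with this expression gives the bound.
  obtain ⟨c, hc, h⟩ := (T.codRestrict (LinearMap.range (T : K × E →ₗ[ℂ] H))
    fun p => ⟨p, rfl⟩).exists_preimage_norm_le (by rintro ⟨_, p, rfl⟩; exact ⟨p, rfl⟩)
  refine ⟨c, hc, fun x hx => ?_⟩
  rw [← hR] at hx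
  obtain ⟨p, hp, hpn⟩ := h ⟨x, hx⟩
  have hpx : A.adjoint p.1 + B.adjoint p.2 = x := congrArg Subtype.val hp
  have hpn' : ‖p‖ ≤ c * ‖x‖ := hpn
  have h1 : ‖x‖ * ‖x‖ ≤ (c * (‖A x‖ + ‖B x‖)) * ‖x‖ := by
    calc ‖x‖ * ‖x‖ = ‖(inner 𝔄 x x : 𝔄)‖ := by rw [← CStarModule.norm_sq_eq, sq]
      _ = ‖(inner 𝔄 (A x) p.1 + inner 𝔄 (B x) p.2 : 𝔄)‖ := by
        nth_rewrite 2 [← hpx]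
        rw [CStarModule.inner_add_right, inner_adjoint_right, inner_adjoint_right]
      _ ≤ ‖A x‖ * ‖p.1‖ + ‖B x‖ * ‖p.2‖ :=
        (norm_add_le _ _).trans
          (add_le_add (CStarModule.norm_inner_le K) (CStarModule.norm_inner_le E))
      _ ≤ ‖A x‖ * (c * ‖x‖) + ‖B x‖ * (c * ‖x‖) := by
        gcongr
        · exact (norm_fst_le p).trans hpn'
        · exact (norm_snd_le p).trans hpn'
      _ = (c * (‖A x‖ + ‖B x‖)) * ‖x‖ := by ring
  rcases eq_or_ne x 0 with rfl | h0
  · simp only [norm_zero]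
    positivity
  · exact le_of_mul_le_mul_right h1 (norm_pos_iff.2 h0)

/-- If `𝓡(A⋆) + 𝓡(B⋆)` is closed, then `A⋆ V A + B⋆ W B` maps it onto itself. -/
theorem exists_weightedSum_eq (hcl : IsClosed (A.adjoint.range + B.adjoint.range))
    (hV : V.IsPosDef) (hW : W.IsPosDef) {y : H} (hy : y ∈ A.adjoint.range + B.adjoint.range) :
    ∃ x ∈ A.adjoint.range + B.adjoint.range, weightedSum A B V W x = y := by
  obtain ⟨c, hc, hcx⟩ := exists_norm_le_of_isClosed hcl
  obtain ⟨v, hv, hvx⟩ := hV.exists_le_norm_inner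
  obtain ⟨w, hw, hwx⟩ := hW.exists_le_norm_inner
  let R : Submodule ℂ H :=
    LinearMap.range A.adjoint.toLinearMap ⊔ LinearMap.range B.adjoint.toLinearMap
  have hR : (R : Set H) = A.adjoint.range + B.adjoint.range := Submodule.coe_sup _ _
  rw [← hR] at hcl
  have : CompleteSpace R := hcl.completeSpace_coe
  have hmem : ∀ x, x ∈ R ↔ x ∈ A.adjoint.range + B.adjoint.range := fun x => by
    rw [← hR]
    rfl
  let G : R →L[ℂ] R := ((weightedSum A B V W).toCLM ∘L R.subtypeL).codRestrict R
    fun x => (hmem _).2 (weightedSum_mem _)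
  set m := min v w
  have hm : 0 < m := lt_min hv hw
  have hG : Function.Surjective G := by
    -- Both m‖Ax‖² and m‖Bx‖² are at most ‖x‖‖z‖, since the norm is monotone on positive elements;
    -- with ‖x‖² ≤ 2c²(‖Ax‖² + ‖Bx‖²) this gives m‖x‖ ≤ (2c)²‖z‖.
    refine G.surjective_of_forall_add_smul_bounded_below
      (c := m / (2 * c) ^ 2) (by positivity) ?_
    rintro s hs ⟨x, hx⟩
    change m / (2 * c) ^ 2 * ‖x‖ ≤ ‖weightedSum A B V W x + (s : ℂ) • x‖
    rw [Complex.coe_smul]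
    set z := weightedSum A B V W x + s • x with hz
    have hin : (inner 𝔄 x z : 𝔄) = inner 𝔄 (A x) (V (A x)) + inner 𝔄 (B x) (W (B x))
        + s • inner 𝔄 x x := by
      rw [hz, CStarModule.inner_add_right, inner_weightedSum, CStarModule.inner_smul_right_real]
    have hsx : (0 : 𝔄) ≤ s • inner 𝔄 x x := smul_nonneg hs CStarModule.inner_self_nonneg
    have hcs : ‖(inner 𝔄 x z : 𝔄)‖ ≤ ‖x‖ * ‖z‖ := CStarModule.norm_inner_le H
    have hA : m * ‖A x‖ ^ 2 ≤ ‖x‖ * ‖z‖ := by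
      calc m * ‖A x‖ ^ 2 ≤ v * ‖A x‖ ^ 2 := by gcongr; exact min_le_left _ _
        _ ≤ _ := hvx _
        _ ≤ ‖(inner 𝔄 x z : 𝔄)‖ := by
          refine CStarAlgebra.norm_le_norm_of_nonneg_of_le (hV.2 _) ?_
          rw [hin, add_assoc]
          exact le_add_of_nonneg_right (add_nonneg (hW.2 _) hsx)
        _ ≤ _ := hcs
    have hB : m * ‖B x‖ ^ 2 ≤ ‖x‖ * ‖z‖ := by
      calc m * ‖B x‖ ^ 2 ≤ w * ‖B x‖ ^ 2 := by gcongr; exact min_le_right _ _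
        _ ≤ _ := hwx _
        _ ≤ ‖(inner 𝔄 x z : 𝔄)‖ := by
          refine CStarAlgebra.norm_le_norm_of_nonneg_of_le (hW.2 _) ?_
          rw [hin, add_right_comm]
          exact le_add_of_nonneg_left (add_nonneg (hV.2 _) hsx)
        _ ≤ _ := hcs
    have hx2 : ‖x‖ ^ 2 ≤ c ^ 2 * (2 * (‖A x‖ ^ 2 + ‖B x‖ ^ 2)) := by
      calc ‖x‖ ^ 2 ≤ (c * (‖A x‖ + ‖B x‖)) ^ 2 := by
            gcongr
            exact hcx x ((hmem x).1 hx)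
        _ = c ^ 2 * (‖A x‖ + ‖B x‖) ^ 2 := mul_pow _ _ _
        _ ≤ _ := by gcongr; exact add_sq_le
    have hfin : m * ‖x‖ * ‖x‖ ≤ ((2 * c) ^ 2 * ‖z‖) * ‖x‖ := by
      calc m * ‖x‖ * ‖x‖ = m * ‖x‖ ^ 2 := by ring
        _ ≤ m * (c ^ 2 * (2 * (‖A x‖ ^ 2 + ‖B x‖ ^ 2))) := by gcongr
        _ = c ^ 2 * 2 * (m * ‖A x‖ ^ 2 + m * ‖B x‖ ^ 2) := by ring
        _ ≤ c ^ 2 * 2 * (‖x‖ * ‖z‖ + ‖x‖ * ‖z‖) := by gcongr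
        _ = _ := by ring
    rcases eq_or_ne x 0 with h0 | h0
    · rw [h0, norm_zero, mul_zero]
      exact norm_nonneg _
    · rw [div_mul_eq_mul_div, div_le_iff₀' (by positivity)]
      exact le_of_mul_le_mul_right hfin (norm_pos_iff.2 h0)
  obtain ⟨⟨x, hx⟩, hxy⟩ := hG ⟨y, (hmem y).2 hy⟩
  exact ⟨x, (hmem x).1 hx, congrArg Subtype.val hxy⟩

/-- If `𝓡(A⋆) + 𝓡(B⋆)` is closed, then `𝓝(A) ∩ 𝓝(B)` is orthogonally complemented. -/
theorem exists_isProjectionOnto (hcl : IsClosed (A.adjoint.range + B.adjoint.range)) :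
    ∃ P : Adjointable 𝔄 H H, P.IsProjectionOnto (A.ker ∩ B.ker) ∧
      ∀ x, x - P x ∈ A.adjoint.range + B.adjoint.range := by
  have hdec : ∀ x, ∃ n ∈ A.ker ∩ B.ker, x - n ∈ A.adjoint.range + B.adjoint.range := by
    intro x
    -- With identity weights, choose r in the range sum having the same image as x; then x - r is
    -- killed by A⋆A + B⋆B, so lies in both null spaces.
    obtain ⟨r, hr, hrx⟩ := exists_weightedSum_eq hcl isPosDef_id isPosDef_id
      (weightedSum_mem (A := A) (B := B) (V := Adjointable.id 𝔄 K) (W := Adjointable.id 𝔄 E) x)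
    refine ⟨x - r, mem_ker_inter_ker isPosDef_id isPosDef_id ?_, by simpa using hr⟩
    rw [map_sub, hrx, sub_self, CStarModule.inner_zero_right]
  choose p hpk hpr using hdec
  have horth : ∀ {r n : H}, r ∈ A.adjoint.range + B.adjoint.range → n ∈ A.ker ∩ B.ker →
      (inner 𝔄 n r : 𝔄) = 0 := fun hr hn => by
    rw [← CStarModule.star_inner, inner_eq_zero_of_mem hr hn, star_zero]
  have hfix : ∀ n ∈ A.ker ∩ B.ker, p n = n := by
    intro n hn
    have h1 := inner_eq_zero_of_mem (hpr n) hn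
    have h2 := inner_eq_zero_of_mem (hpr n) (hpk n)
    have h3 : (inner 𝔄 (n - p n) (n - p n) : 𝔄) = 0 := by
      rw [CStarModule.inner_sub_right, h1, h2, sub_zero]
    exact (sub_eq_zero.1 (CStarModule.inner_self.1 h3)).symm
  -- Orthogonality of the two summands makes the chosen map p its own adjoint, so its linearity need
  -- not be checked.
  refine ⟨⟨p, p, fun x y => ?_⟩, ⟨ext fun x => hfix _ (hpk x), rfl, ?_⟩, hpr⟩
  · have h1 := horth (hpr y) (hpk x)
    have h2 := inner_eq_zero_of_mem (hpr x) (hpk y)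
    rw [CStarModule.inner_sub_right, sub_eq_zero] at h1
    rw [CStarModule.inner_sub_left, sub_eq_zero] at h2
    rw [h1, h2]
  · ext n
    exact ⟨by rintro ⟨x, rfl⟩; exact hpk x, fun hn => ⟨n, hfix n hn⟩⟩

/-- The operator `U = A⋆ V A + B⋆ W B + P` is positive definite. -/
theorem isPosDef_weightedSum_add (hcl : IsClosed (A.adjoint.range + B.adjoint.range))
    (hV : V.IsPosDef) (hW : W.IsPosDef) (hP : P.IsProjectionOnto (A.ker ∩ B.ker))
    (hPr : ∀ x, x - P x ∈ A.adjoint.range + B.adjoint.range) :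
    (weightedSum A B V W + P).IsPosDef := by
  set U := weightedSum A B V W + P with hU
  have hUsa : U.adjoint = U := by rw [hU, adjoint_add, adjoint_weightedSum hV hW, hP.2.1]
  have hPin : ∀ x, (inner 𝔄 x (P x) : 𝔄) = inner 𝔄 (P x) (P x) := fun x => by
    conv_rhs => rw [← P.inner_adjoint_right, hP.2.1, hP.apply_apply]
  have hUin : ∀ x, (inner 𝔄 x (U x) : 𝔄) =
      inner 𝔄 x (weightedSum A B V W x) + inner 𝔄 (P x) (P x) := fun x => by
    rw [hU, add_apply, CStarModule.inner_add_right, hPin]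
  have hSpos : ∀ x, (0 : 𝔄) ≤ inner 𝔄 x (weightedSum A B V W x) := fun x => by
    rw [inner_weightedSum]
    exact add_nonneg (hV.2 _) (hW.2 _)
  have hinj : ∀ x, U x = 0 → x = 0 := by
    intro x hx
    have h1 := hUin x
    rw [hx, CStarModule.inner_zero_right, eq_comm,
      add_eq_zero_iff_of_nonneg (hSpos x) CStarModule.inner_self_nonneg] at h1
    have h2 := mem_ker_inter_ker hV hW h1.1
    have h3 : P x = 0 := CStarModule.inner_self.1 h1.2
    obtain ⟨z, rfl⟩ : x ∈ P.range := hP.2.2 ▸ h2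
    rwa [hP.apply_apply] at h3
  have hsurj : ∀ y, ∃ x, U x = y := by
    intro y
    obtain ⟨r, hr, hry⟩ := exists_weightedSum_eq hcl hV hW (hPr y)
    refine ⟨r + P y, ?_⟩
    rw [hU, add_apply, map_add, map_add, hry, weightedSum_eq_zero (hP.apply_mem y),
      hP.apply_eq_zero hr, hP.apply_apply]
    abel
  choose N hN using hsurj
  -- The pointwise inverse of a self-adjoint bijection is its own adjoint, hence already
  -- adjointable.
  refine ⟨⟨hUsa, ⟨N, N, fun x y => ?_⟩, ext hN, ext fun x => ?_⟩, fun x => ?_⟩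
  · conv_lhs => rw [← hN y, ← U.inner_adjoint_left, hUsa, hN]
  · refine sub_eq_zero.1 (hinj _ ?_)
    rw [map_sub]
    exact sub_eq_zero.2 (hN _)
  · rw [hUin]
    exact add_nonneg (hSpos x) CStarModule.inner_self_nonneg

end weightedSum

end Adjointable

/-! ### The main theorem -/

theorem mainTheorem11 {𝔄 H K E : Type*}
    [NonUnitalCStarAlgebra 𝔄] [PartialOrder 𝔄] [StarOrderedRing 𝔄]
    [NormedAddCommGroup H] [NormedSpace ℂ H] [SMul 𝔄 H] [CStarModule 𝔄 H] [CompleteSpace H]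
    [NormedAddCommGroup K] [NormedSpace ℂ K] [SMul 𝔄 K] [CStarModule 𝔄 K] [CompleteSpace K]
    [NormedAddCommGroup E] [NormedSpace ℂ E] [SMul 𝔄 E] [CStarModule 𝔄 E] [CompleteSpace E]
    (A : Adjointable 𝔄 H K) (B : Adjointable 𝔄 H E) (V : Adjointable 𝔄 K K)
    (hAB : Adjointable.IsSeparatedPair A B) (hV : V.IsPosDef) :
    -- the projection onto the common null space exists
    ∃ P : Adjointable 𝔄 H H, P.IsProjectionOnto (A.ker ∩ B.ker) ∧
      -- one operator `X`, chosen before `W` and `t`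
      ∃ X : Adjointable 𝔄 K H, ∀ W : Adjointable 𝔄 E E, W.IsPosDef →
        (A.adjoint ⊚ V ⊚ A + B.adjoint ⊚ W ⊚ B + P).IsPosDef ∧
        Adjointable.IsWeightedMPInverse V
          (A.adjoint ⊚ V ⊚ A + B.adjoint ⊚ W ⊚ B + P) A X ∧
        ∀ t : ℝ, 0 < t → ∃ Y : Adjointable 𝔄 H H,
          Adjointable.IsMPInverse (A.adjoint ⊚ V ⊚ A + t • (B.adjoint ⊚ W ⊚ B)) Y ∧
          Y ⊚ A.adjoint ⊚ V = X := by
  obtain ⟨hdisj, hcl⟩ := hAB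
  obtain ⟨P, hP, hPr⟩ := Adjointable.exists_isProjectionOnto hcl
  have hU : ∀ W : Adjointable 𝔄 E E, W.IsPosDef →
      (Adjointable.weightedSum A B V W + P).IsPosDef :=
    fun W hW => Adjointable.isPosDef_weightedSum_add hcl hV hW hP hPr
  -- The reference weight W = 1 fixes X before W and t are given.
  obtain ⟨⟨-, Q₀, hQ₀, -⟩, -⟩ := hU _ Adjointable.isPosDef_id
  have hind : ∀ {W : Adjointable 𝔄 E E} {Q : Adjointable 𝔄 H H},
      Q ⊚ (Adjointable.weightedSum A B V W + P) = Adjointable.id 𝔄 H →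
      Q ⊚ A.adjoint ⊚ V = Q₀ ⊚ A.adjoint ⊚ V := fun hQ' =>
    congrArg (fun T : Adjointable 𝔄 K H => T ⊚ V)
      (Adjointable.inverse_comp_adjoint_eq hdisj Adjointable.isPosDef_id hP hQ₀ hQ')
  refine ⟨P, hP, Q₀ ⊚ A.adjoint ⊚ V, fun W hW => ⟨hU W hW, ?_, fun t ht => ?_⟩⟩
  · obtain ⟨⟨-, Q, hQ, hQ'⟩, -⟩ := hU W hW
    rw [← hind hQ']
    exact Adjointable.isWeightedMPInverse_inverse_comp hdisj hV hW hP hQ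
  · obtain ⟨⟨-, Q, hQ, hQ'⟩, -⟩ := hU _ (hW.smul ht)
    rw [← hind hQ', ← Adjointable.weightedSum_smul]
    exact Adjointable.exists_isMPInverse_weightedSum hV (hW.smul ht) hP hQ hQ'
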